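/- Let $\mathcal A=\{A_1,\dots,A_k\}$ be a finite set of nonempty affine subspaces of $\mathbb R^n$, none of which is contained in another, and let $\mathcal U=\bigcup_i A_i$. *Homotopy colimits.* For a poset $Q$ let $\Delta(Q)$ be the geometric realization of the simplicial complex of nonempty finite chains of $Q$, let $Q_{\le x}=\{y\in Q: y\le x\}$, and let $\mathrm{Bd}(Q)$ be the poset of nonempty finite chains of $Q$ ordered by inclusion. Let $\mathcal D$ be a diagram of topological spaces over $Q$, with a continuous map $\mathcal D(x\to y):\mathcal D(x)\to\mathcal D(y)$ for each $x\ge y$. Its homotopy colimit $\mathbf{hocolim}(\mathcal D)$ is the colimit, in the category of topological spaces, of the diagram over $\mathrm{Bd}(Q)$ that sends a chain $x_1>\dots>x_t$ to $\Delta(Q_{\le x_t})\times\mathcal D(x_1)$, and sends the passage to a subchain $x_{i_1}>\dots>x_{i_p}$ to the product of the inclusion $\Delta(Q_{\le x_t})\hookrightarrow\Delta(Q_{\le x_{i_p}})$ and the map $\mathcal D(x_1\to x_{i_1})$. *The Vassiliev diagram.* Let $\mathcal L$ be the intersection semilattice of $\mathcal A$: the set of all nonempty intersections of one or more of the $A_i$,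 ordered by reverse inclusion. Its minimal elements $a_1,\dots,a_k$ correspond to $A_1,\dots,A_k$. Let $\mathcal N(\mathcal L)$ be the nerve complex: its vertices are the minimal elements of $\mathcal L$, and its simplices are the nonempty sets of minimal elements that have a join in $\mathcal L$. Let $P=\mathcal F(\mathcal N(\mathcal L))$ be its face poset (nonempty faces ordered by inclusion). The Vassiliev diagram $\mathcal V$ over $P$ sends $\{a_{i_1},\dots,a_{i_q}\}$ to $A_{i_1}\cap\dots\cap A_{i_q}$, and its maps are inclusions. *The geometric resolution.* Let $e_i:A_i\to\mathbb R^N$ $(1\le i\le k)$ be injective affine maps, and for $x\in\mathcal U$ let $V(x)\subset\mathbb R^N$ be the convex hull of the points $e_i(x)$ over all $i$ with $x\in A_i$. Call $(e_i)$ *generic* if for every $x\in\mathcal U$ the points $e_i(x)$ ($i$ with $x\in A_i$) are affinely independent (so that $V(x)$ is a simplex with these points as its vertices), and $V(x)\cap V(y)=\emptyset$ for all $x\ne y$ in $\mathcal U$. The geometric resolution is $V(\mathcal A)=\bigcup_{x\in\mathcal U}V(x)\subset\mathbb R^N$ with the subspace topology. Below, $X\cup\{\infty\}$ denotes the one-point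 compactification of $X$ (if $X$ is compact, $\infty$ is an isolated point), and $\widehat V(\mathcal A)=V(\mathcal A)\cup\{\infty\}$. **Theorem.** For all sufficiently large $N$ generic systems $(e_i)$ exist. For every $N$ and every generic system $(e_i)$ of affine embeddings into $\mathbb R^N$, the space $\mathbf{hocolim}(\mathcal V)\cup\{\infty\}$ is homeomorphic to $\widehat V(\mathcal A)$. More precisely, there is a homeomorphism that fixes $\infty$ and is given by barycentric subdivision of the simplices $V(x)$: for every chain $\sigma_1>\dots>\sigma_t$ in $P$, every $w\in\Delta(P_{\le\sigma_t})$ with barycentric coordinates $(w_\tau)_{\tau\le\sigma_t}$, and every $x\in\mathcal V(\sigma_1)$, it sends the class of $(w,x)$ to $$\sum_{\tau\le\sigma_t} w_\tau\cdot\frac1{|\tau|}\sum_{a_i\in\tau}e_i(x)\ \in V(x).$$ -/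

import Mathlib

open CategoryTheory CategoryTheory.Limits Opposite

namespace VassilievModel

universe u

/-! ### Geometric realizations and order complexes -/

section Realization

variable {ι κ : Type u}

/-- The geometric realization `|K|` of a simplicial complex `K`: its points are given by their
barycentric coordinates, i.e. they are the finitely supported functions on the vertices which are
nonnegative, have total mass `1`, and whose support is a face of `K`. -/
def Realization (K : PreAbstractSimplicialComplex ι) : Type u :=
  {w : ι →₀ ℝ // (∀ i, 0 ≤ w i) ∧ (w.sum fun _ t => t) = 1 ∧ w.support ∈ K.faces}

/-- The closed simplex of `|K|` spanned by the set of vertices `s`. -/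
def ClosedSimplex (K : PreAbstractSimplicialComplex ι) (s : Finset ι) : Type u :=
  {w : Realization K // w.1.support ⊆ s}

/-- The inclusion of a closed simplex into `|K|`. -/
def ClosedSimplex.incl {K : PreAbstractSimplicialComplex ι} {s : Finset ι}
    (w : ClosedSimplex K s) : Realization K := w.1

/-- A closed simplex carries the topology given by its barycentric coordinates. -/
instance (K : PreAbstractSimplicialComplex ι) (s : Finset ι) :
    TopologicalSpace (ClosedSimplex K s) :=
  TopologicalSpace.induced (fun w => (w.1.1 : ι → ℝ)) inferInstance

/-- `|K|` carries the weak topology: a subset is open (closed) if and only if its trace on each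
closed simplex spanned by a face of `K` is open (closed). -/
instance (K : PreAbstractSimplicialComplex ι) : TopologicalSpace (Realization K) :=
  ⨆ s : K.faces, TopologicalSpace.coinduced
    (ClosedSimplex.incl : ClosedSimplex K s.1 → Realization K) inferInstance

/-- A map of vertices sending faces of `K` to faces of `L` induces a map of realizations, which is
affine on each simplex. -/
noncomputable def Realization.map {K : PreAbstractSimplicialComplex ι}
    {L : PreAbstractSimplicialComplex κ} [DecidableEq κ] (f : ι → κ)
    (hf : ∀ s ∈ K.faces, s.image f ∈ L.faces) (w : Realization K) : Realization L :=
  ⟨w.1.mapDomain f, by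
    obtain ⟨w, h0, h1, h2⟩ := w
    have hsum : ((w.mapDomain f).sum fun _ t => t) = 1 := by
      rw [Finsupp.sum_mapDomain_index (by simp) (by simp), h1]
    refine ⟨fun j => ?_, hsum, ?_⟩
    · rw [Finsupp.mapDomain, Finsupp.sum_apply]
      refine Finset.sum_nonneg fun i _ => ?_
      simp only [Finsupp.single_apply]
      split_ifs
      · exact h0 i
      · exact le_rfl
    · refine (L.isRelLowerSet_faces (hf _ h2)).2 Finsupp.mapDomain_support ?_
      rw [Finset.nonempty_iff_ne_empty]
      intro h
      rw [Finsupp.support_eq_empty] at h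
      simp [h] at hsum⟩

theorem Realization.continuous_map {K : PreAbstractSimplicialComplex ι}
    {L : PreAbstractSimplicialComplex κ} [DecidableEq κ] (f : ι → κ)
    (hf : ∀ s ∈ K.faces, s.image f ∈ L.faces) :
    Continuous (Realization.map (K := K) (L := L) f hf) := by
  rw [continuous_iSup_dom]
  intro s
  rw [continuous_coinduced_dom]
  let g : ClosedSimplex K s.1 → ClosedSimplex L (s.1.image f) := fun w =>
    ⟨Realization.map f hf w.1,
      Finsupp.mapDomain_support.trans (Finset.image_subset_image w.2)⟩
  have hg : Continuous g := by
    rw [continuous_induced_rng, continuous_pi_iff]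
    intro j
    have key : ∀ w : ClosedSimplex K s.1,
        ((g w).1.1 : κ → ℝ) j = ∑ i ∈ s.1, if f i = j then (w.1.1 : ι → ℝ) i else 0 := by
      intro w
      change (w.1.1.mapDomain f) j = _
      rw [Finsupp.mapDomain, Finsupp.sum_apply,
        Finsupp.sum_of_support_subset _ w.2 _ (by simp)]
      simp only [Finsupp.single_apply]
    have : (fun w : ClosedSimplex K s.1 => ((g w).1.1 : κ → ℝ) j) =
        fun w => ∑ i ∈ s.1, if f i = j then (w.1.1 : ι → ℝ) i else 0 := funext key
    change Continuous (fun w : ClosedSimplex K s.1 => ((g w).1.1 : κ → ℝ) j)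
    rw [this]
    refine continuous_finsetSum _ fun i _ => ?_
    split_ifs
    · exact (continuous_apply i).comp continuous_induced_dom
    · exact continuous_const
  have hval : Continuous (ClosedSimplex.incl : ClosedSimplex L (s.1.image f) → Realization L) := by
    rw [continuous_iff_coinduced_le]
    exact le_iSup (fun t : L.faces => TopologicalSpace.coinduced
      (ClosedSimplex.incl : ClosedSimplex L t.1 → Realization L) inferInstance)
      ⟨s.1.image f, hf _ s.2⟩
  exact hval.comp hg

end Realization

section Posets

variable (P : Type u) [PartialOrder P]

/-- The simplicial complex of nonempty finite chains of a poset. -/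
def chainComplex : PreAbstractSimplicialComplex P where
  faces := {s | s.Nonempty ∧ IsChain (· ≤ ·) (s : Set P)}
  isRelLowerSet_faces := fun _ hs =>
    ⟨hs.1, fun _ hts ht => ⟨ht, hs.2.mono (Finset.coe_subset.2 hts)⟩⟩

/-- The order complex `Δ(P)` of a poset, as a topological space. -/
abbrev OrderComplex : Type u := Realization (chainComplex P)

variable {P}

/-- The inclusion `I(y ↪ x) : Δ(P_{≤ y}) → Δ(P_{≤ x})`, for `y ≤ x`. -/
noncomputable def orderComplexInclusion {x y : P} (h : y ≤ x) :
    C(OrderComplex (Set.Iic y), OrderComplex (Set.Iic x)) :=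
  letI := Classical.decEq (Set.Iic x)
  have hf : ∀ s ∈ (chainComplex (Set.Iic y)).faces,
      s.image (Set.inclusion (Set.Iic_subset_Iic.2 h)) ∈ (chainComplex (Set.Iic x)).faces := by
    intro s hs
    refine ⟨hs.1.image _, ?_⟩
    rw [Finset.coe_image]
    rintro _ ⟨a, ha, rfl⟩ _ ⟨b, hb, rfl⟩ hab
    exact hs.2 ha hb fun h => hab (congrArg _ h)
  ⟨Realization.map (Set.inclusion (Set.Iic_subset_Iic.2 h)) hf,
    Realization.continuous_map _ hf⟩

theorem orderComplexInclusion_val {x y : P} (h : y ≤ x) (w : OrderComplex (Set.Iic y)) :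
    (orderComplexInclusion h w).1 =
      w.1.mapDomain (Set.inclusion (Set.Iic_subset_Iic.2 h)) := rfl

/-! ### Barycentric subdivision and homotopy colimits -/

variable (P) in
/-- The barycentric subdivision `Bd(P)`: the nonempty (finite) chains of `P`, ordered by
inclusion. -/
abbrev Bd : Type u := PartialOrder.NonemptyFiniteChains P

theorem exists_isGreatest (c : Bd P) :
    ∃ x, IsGreatest (c.finset : Set P) x := by
  obtain ⟨x, hx⟩ := c.finset.exists_maximal c.nonempty
  exact ⟨x, hx.1, fun y hy => (c.comparable ⟨x, hx.1⟩ ⟨y, hy⟩).elim (fun h => hx.2 hy h) id⟩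

theorem exists_isLeast (c : Bd P) :
    ∃ x, IsLeast (c.finset : Set P) x := by
  obtain ⟨x, hx⟩ := c.finset.exists_minimal c.nonempty
  exact ⟨x, hx.1, fun y hy => (c.comparable ⟨x, hx.1⟩ ⟨y, hy⟩).elim id (fun h => hx.2 hy h)⟩

/-- The largest element `x₁` of a chain `x₁ > ⋯ > x_t`. -/
noncomputable def chainTop (c : Bd P) : P := (exists_isGreatest c).choose

/-- The smallest element `x_t` of a chain `x₁ > ⋯ > x_t`. -/
noncomputable def chainBot (c : Bd P) : P := (exists_isLeast c).choose

theorem isGreatest_chainTop (c : Bd P) :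
    IsGreatest (c.finset : Set P) (chainTop c) := (exists_isGreatest c).choose_spec

theorem isLeast_chainBot (c : Bd P) :
    IsLeast (c.finset : Set P) (chainBot c) := (exists_isLeast c).choose_spec

theorem chainTop_mono {c d : Bd P} (h : d ≤ c) : chainTop d ≤ chainTop c :=
  (isGreatest_chainTop c).2 (h (isGreatest_chainTop d).1)

theorem chainBot_anti {c d : Bd P} (h : d ≤ c) : chainBot c ≤ chainBot d :=
  (isLeast_chainBot c).2 (h (isLeast_chainBot d).1)

theorem chainBot_le_chainTop (c : Bd P) : chainBot c ≤ chainTop c :=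
  (isLeast_chainBot c).2 (isGreatest_chainTop c).1

/-- For a diagram `D` of spaces over a poset `P` (where a relation `x ≥ y` induces a continuous map
`D(x) → D(y)`, so that `D` is a functor on `Pᵒᵖ` in the usual orientation of a poset category), the
diagram over `Bd(P)` with spaces `(x₁ > ⋯ > x_t) ↦ Δ(P_{≤ x_t}) × D(x₁)`; the map from a chain to
a subchain is the product of the inclusion of order complexes and the map of `D`. -/
noncomputable def hocolimDiagram (D : Pᵒᵖ ⥤ TopCat.{u}) :
    (Bd P)ᵒᵖ ⥤ TopCat.{u} where
  obj c := TopCat.of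
    (OrderComplex (Set.Iic (chainBot c.unop)) × D.obj (op (chainTop c.unop)))
  map {c d} f := TopCat.ofHom
    ((orderComplexInclusion (chainBot_anti (leOfHom f.unop))).prodMap
      (D.map (homOfLE (chainTop_mono (leOfHom f.unop))).op).hom)
  map_id c := by
    refine TopCat.hom_ext (ContinuousMap.ext ?_)
    rintro ⟨w, x⟩
    refine Prod.ext (Subtype.ext ?_) ?_
    · exact Finsupp.mapDomain_id
    · change D.map (𝟙 _) x = x
      simp
  map_comp {c d e} f g := by
    refine TopCat.hom_ext (ContinuousMap.ext ?_)
    rintro ⟨w, x⟩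
    refine Prod.ext (Subtype.ext ?_) ?_
    · exact Finsupp.mapDomain_comp (v := w.1)
        (f := Set.inclusion (Set.Iic_subset_Iic.2 (chainBot_anti (leOfHom f.unop))))
        (g := Set.inclusion (Set.Iic_subset_Iic.2 (chainBot_anti (leOfHom g.unop))))
    · change D.map _ x = D.map _ (D.map _ x)
      rw [← CategoryTheory.comp_apply, ← D.map_comp]
      rfl

/-- The homotopy colimit of a diagram of spaces over a poset. -/
noncomputable def hocolim (D : Pᵒᵖ ⥤ TopCat.{u}) : TopCat.{u} := colimit (hocolimDiagram D)

/-- The canonical map `Δ(P_{≤ x_t}) × D(x₁) → hocolim D` belonging to a chain `x₁ > ⋯ > x_t`. -/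
noncomputable def hocolimMk (D : Pᵒᵖ ⥤ TopCat.{u}) (c : Bd P)
    (w : OrderComplex (Set.Iic (chainBot c))) (x : D.obj (op (chainTop c))) : hocolim D :=
  colimit.ι (hocolimDiagram D) (op c) (w, x)

/-! ### Semilattices and nerve complexes -/

/-- Two elements with a common upper bound have a least one, and two elements with a common lower
bound have a greatest one. -/
class IsSemilattice (P : Type u) [PartialOrder P] : Prop where
  exists_isLUB : ∀ x y : P, BddAbove {x, y} → ∃ z, IsLUB {x, y} z
  exists_isGLB : ∀ x y : P, BddBelow {x, y} → ∃ z, IsGLB {x, y} z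

theorem exists_isLUB_of_bddAbove [IsSemilattice P] {s : Finset P} (hs : s.Nonempty)
    (h : BddAbove (s : Set P)) : ∃ z, IsLUB (s : Set P) z := by
  classical
  induction hs using Finset.Nonempty.cons_induction with
  | singleton a => exact ⟨a, by simp⟩
  | cons a s ha hs ih =>
    obtain ⟨b, hb⟩ := h
    simp only [Finset.coe_cons] at hb ⊢
    obtain ⟨z, hz⟩ := ih ⟨b, fun x hx => hb (Set.mem_insert_of_mem _ hx)⟩
    have hzb : z ≤ b := hz.2 fun x hx => hb (Set.mem_insert_of_mem _ hx)
    obtain ⟨y, hy⟩ := IsSemilattice.exists_isLUB a z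
      ⟨b, by rintro x (rfl | rfl); exacts [hb (Set.mem_insert _ _), hzb]⟩
    refine ⟨y, ?_, ?_⟩
    · rintro x (rfl | hx)
      · exact hy.1 (by simp)
      · exact (hz.1 hx).trans (hy.1 (by simp))
    · intro u hu
      refine hy.2 ?_
      rintro x (rfl | rfl)
      · exact hu (Set.mem_insert _ _)
      · exact hz.2 fun x hx => hu (Set.mem_insert_of_mem _ hx)

variable (P) in
/-- The nerve complex `N(P)` of a semilattice: the vertices are the minimal elements of `P`, and
the simplices are the nonempty finite sets of minimal elements which have a join in `P`. -/
def nerveComplex [IsSemilattice P] : AbstractSimplicialComplex {a : P // IsMin a} where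
  faces := {s | s.Nonempty ∧ ∃ z : P, IsLUB (Subtype.val '' (s : Set {a : P // IsMin a})) z}
  isRelLowerSet_faces := by
    classical
    rintro s ⟨hs, z, hz⟩
    refine ⟨hs, fun t hts ht => ⟨ht, ?_⟩⟩
    have := exists_isLUB_of_bddAbove (s := t.image Subtype.val) (ht.image _)
      ⟨z, by
        rw [Finset.coe_image]
        exact fun x hx => hz.1 (Set.image_mono (Finset.coe_subset.2 hts) hx)⟩
    rwa [Finset.coe_image] at this
  singleton_mem := fun v => ⟨Finset.singleton_nonempty v, v.1, by simp⟩

end Posets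

/-- The face poset `F(K)` of a simplicial complex: its nonempty faces, ordered by inclusion. -/
abbrev FacePoset {ι : Type u} (K : AbstractSimplicialComplex ι) : Type u := K.faces

/-! ### Subspace arrangements -/

/-- `ℝⁿ`. -/
abbrev E (n : ℕ) : Type := EuclideanSpace ℝ (Fin n)

/-- A (finite) arrangement of (nonempty) affine subspaces of `ℝⁿ`, none contained in another. -/
structure SubspaceArrangement (n : ℕ) where
  subspaces : Finset (AffineSubspace ℝ (E n))
  nonempty : ∀ A ∈ subspaces, (A : Set (E n)).Nonempty
  eq_of_le : ∀ A ∈ subspaces, ∀ B ∈ subspaces, A ≤ B → A = B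

namespace SubspaceArrangement

variable {n : ℕ} (𝒜 : SubspaceArrangement n)

instance (A : 𝒜.subspaces) : Nonempty A.1 := (𝒜.nonempty A.1 A.2).to_subtype

/-- The union `U(𝒜)` of the subspaces of the arrangement. -/
def union : Set (E n) := ⋃ A ∈ 𝒜.subspaces, (A : Set (E n))

/-- The intersection semilattice `L(𝒜)`: the nonempty intersections of (one or more) subspaces of
the arrangement, ordered by reverse inclusion. -/
def IntersectionSemilattice : Type :=
  {X : (AffineSubspace ℝ (E n))ᵒᵈ // ((OrderDual.ofDual X : AffineSubspace ℝ (E n)) : Set (E n)).Nonempty ∧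
    ∃ S : Finset (AffineSubspace ℝ (E n)), S ⊆ 𝒜.subspaces ∧ S.Nonempty ∧
      OrderDual.ofDual X = sInf (S : Set (AffineSubspace ℝ (E n)))}

instance : PartialOrder 𝒜.IntersectionSemilattice := inferInstanceAs (PartialOrder (Subtype _))

variable {𝒜}

/-- The affine subspace `B(x)` indexed by an element `x` of the intersection semilattice. -/
def IntersectionSemilattice.space (x : 𝒜.IntersectionSemilattice) : AffineSubspace ℝ (E n) :=
  OrderDual.ofDual x.1

theorem IntersectionSemilattice.le_iff (x y : 𝒜.IntersectionSemilattice) :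
    x ≤ y ↔ y.space ≤ x.space := Iff.rfl

instance : IsSemilattice 𝒜.IntersectionSemilattice where
  exists_isLUB := by
    classical
    rintro ⟨X, hX, S, hS, hS', hXS⟩ ⟨Y, hY, T, hT, hT', hYT⟩ ⟨Z, hZ⟩
    have hZX := (IntersectionSemilattice.le_iff _ _).1 (hZ (Set.mem_insert _ _))
    have hZY := (IntersectionSemilattice.le_iff _ _).1 (hZ (Set.mem_insert_of_mem _ rfl))
    refine ⟨⟨OrderDual.toDual (OrderDual.ofDual X ⊓ OrderDual.ofDual Y),
      Z.2.1.mono (le_inf hZX hZY), S ∪ T, Finset.union_subset hS hT,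
      hS'.mono Finset.subset_union_left, ?_⟩, ?_, ?_⟩
    · rw [Finset.coe_union, sInf_union, ← hXS, ← hYT]
      rfl
    · rintro W (rfl | rfl)
      · exact (inf_le_left : OrderDual.ofDual X ⊓ OrderDual.ofDual Y ≤ OrderDual.ofDual X)
      · exact (inf_le_right : OrderDual.ofDual X ⊓ OrderDual.ofDual Y ≤ OrderDual.ofDual Y)
    · intro W hW
      have h1 := (IntersectionSemilattice.le_iff _ _).1 (hW (Set.mem_insert _ _))
      have h2 := (IntersectionSemilattice.le_iff _ _).1 (hW (Set.mem_insert_of_mem _ rfl))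
      exact (IntersectionSemilattice.le_iff _ _).2 (le_inf h1 h2)
  exists_isGLB := by
    classical
    rintro X Y ⟨Z, hZ⟩
    have hZX := (IntersectionSemilattice.le_iff _ _).1 (hZ (Set.mem_insert _ _))
    have hZY := (IntersectionSemilattice.le_iff _ _).1 (hZ (Set.mem_insert_of_mem _ rfl))
    obtain ⟨R, hR, hR', hZR⟩ := Z.2.2
    have hRZ : ∀ A ∈ R, Z.space ≤ A := fun A hA => hZR.trans_le (sInf_le hA)
    let S := 𝒜.subspaces.filter fun A => X.space ≤ A ∧ Y.space ≤ A
    have hXS : X.space ≤ sInf (S : Set (AffineSubspace ℝ (E n))) :=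
      le_sInf fun A hA => (Finset.mem_filter.1 hA).2.1
    have hYS : Y.space ≤ sInf (S : Set (AffineSubspace ℝ (E n))) :=
      le_sInf fun A hA => (Finset.mem_filter.1 hA).2.2
    refine ⟨⟨OrderDual.toDual (sInf (S : Set (AffineSubspace ℝ (E n)))),
      X.2.1.mono hXS, S, Finset.filter_subset _ _, ?_, rfl⟩, ?_, ?_⟩
    · obtain ⟨A, hA⟩ := hR'
      exact ⟨A, Finset.mem_filter.2
        ⟨hR hA, hZX.trans (hRZ A hA), hZY.trans (hRZ A hA)⟩⟩
    · rintro W (rfl | rfl)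
      exacts [hXS, hYS]
    · intro W hW
      have h1 := (IntersectionSemilattice.le_iff _ _).1 (hW (Set.mem_insert _ _))
      have h2 := (IntersectionSemilattice.le_iff _ _).1 (hW (Set.mem_insert_of_mem _ rfl))
      obtain ⟨Q, hQ, -, hWQ⟩ := W.2.2
      have hQW : ∀ A ∈ Q, W.space ≤ A := fun A hA => hWQ.trans_le (sInf_le hA)
      refine (IntersectionSemilattice.le_iff _ _).2 (le_of_le_of_eq (le_sInf fun A hA => ?_) hWQ.symm)
      exact sInf_le (Finset.mem_coe.2 (Finset.mem_filter.2
        ⟨hQ hA, h1.trans (hQW A hA), h2.trans (hQW A hA)⟩))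

/-- The minimal elements of the intersection semilattice are the given subspaces. -/
theorem IntersectionSemilattice.isMin_iff (x : 𝒜.IntersectionSemilattice) :
    IsMin x ↔ x.space ∈ 𝒜.subspaces := by
  constructor
  · intro hx
    obtain ⟨S, hS, ⟨A, hA⟩, hxS⟩ := x.2.2
    have hxA : x.space ≤ A := hxS.trans_le (sInf_le hA)
    let a : 𝒜.IntersectionSemilattice :=
      ⟨OrderDual.toDual A, 𝒜.nonempty A (hS hA), {A}, by simpa using hS hA, by simp, by simp⟩
    have hax : a ≤ x := hxA
    have hAx : A ≤ x.space := hx hax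
    rw [le_antisymm hxA hAx]
    exact hS hA
  · intro hx y hyx
    obtain ⟨S, hS, ⟨A, hA⟩, hyS⟩ := y.2.2
    have hyA : y.space ≤ A := hyS.trans_le (sInf_le hA)
    have hxy : x.space ≤ y.space := hyx
    have hxA := 𝒜.eq_of_le _ hx A (hS hA) (hxy.trans hyA)
    exact (IntersectionSemilattice.le_iff _ _).2 (hyA.trans hxA.ge)

variable (𝒜)

/-- The nerve complex of the intersection semilattice. -/
abbrev nerve : AbstractSimplicialComplex {a : 𝒜.IntersectionSemilattice // IsMin a} :=
  nerveComplex 𝒜.IntersectionSemilattice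

/-- The Vassiliev diagram over the face poset of the nerve complex of the intersection semilattice:
a face `{a_{i₁}, …, a_{i_k}}` is sent to `A_{i₁} ∩ ⋯ ∩ A_{i_k}`, and the maps are inclusions. -/
def vassilievDiagram : (FacePoset 𝒜.nerve)ᵒᵖ ⥤ TopCat.{0} where
  obj σ := TopCat.of {x : E n // ∀ a ∈ σ.unop.1, x ∈ a.1.space}
  map {σ τ} f := TopCat.ofHom
    ⟨fun x => ⟨x.1, fun a ha => x.2 a (leOfHom f.unop ha)⟩, by fun_prop⟩
  map_id _ := rfl
  map_comp _ _ := rfl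

/-- A choice of an affine embedding into `ℝᴺ` for each subspace of the arrangement. -/
structure Embeddings (N : ℕ) where
  toFun : ∀ A : 𝒜.subspaces, A.1 →ᵃ[ℝ] E N
  injective : ∀ A, Function.Injective (toFun A)

namespace Embeddings

variable {𝒜} {N : ℕ} (e : 𝒜.Embeddings N)

/-- The images of a point `x`, indexed by the subspaces that contain it. -/
noncomputable def images (x : E n) (A : {A : 𝒜.subspaces // x ∈ A.1}) : E N := e.toFun A.1 ⟨x, A.2⟩

/-- `V(x)`, the convex hull of the images of `x`. -/
def simplexOver (x : E n) : Set (E N) := convexHull ℝ (Set.range (e.images x))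

/-- The embeddings are in general position: every `V(x)` is a simplex whose vertices are the
(pairwise distinct) images of `x`, and the simplices over different points are disjoint. -/
structure IsGeneric : Prop where
  affineIndependent : ∀ x ∈ 𝒜.union, AffineIndependent ℝ (e.images x)
  disjoint : ∀ x ∈ 𝒜.union, ∀ y ∈ 𝒜.union, x ≠ y →
    Disjoint (e.simplexOver x) (e.simplexOver y)

/-- The geometric resolution `V(𝒜)`, a subspace of `ℝᴺ`. -/
def resolution : Set (E N) := ⋃ x ∈ 𝒜.union, e.simplexOver x

/-- For a face `τ` of the nerve and a point `x` in the corresponding intersection, the barycenter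
of the face of `V(x)` spanned by the images of `x` under the embeddings indexed by `τ`. -/
noncomputable def barycenter (τ : FacePoset 𝒜.nerve) (x : E n)
    (hx : ∀ a ∈ τ.1, x ∈ a.1.space) : E N :=
  Finset.univ.centroid ℝ fun a : τ.1 =>
    e.toFun ⟨a.1.1.space, (IntersectionSemilattice.isMin_iff _).1 a.1.2⟩ ⟨x, hx a.1 a.2⟩

/-- The point of `ℝᴺ` obtained from a point `w ∈ Δ(P_{≤ x_t})` of an order complex of faces and a
point `x` of the intersection belonging to `x₁` by interpreting the barycentric coordinates of `w`
with respect to the barycenters of the faces of the simplex `V(x)`. -/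
noncomputable def subdivisionPoint (c : Bd (FacePoset 𝒜.nerve))
    (w : OrderComplex (Set.Iic (chainBot c)))
    (x : 𝒜.vassilievDiagram.obj (op (chainTop c))) : E N :=
  w.1.sum fun τ t => t • e.barycenter τ.1 x.1
    fun a ha => x.2 a ((τ.2.trans (chainBot_le_chainTop c)) ha)

end Embeddings

end SubspaceArrangement

end VassilievModel

/-!
Over a chain `x₁ > ⋯ > x_t` the comparison map sends `(w, x)` to the point of the simplex `V(x)`
whose coordinates with respect to the barycenters of the faces are `w`. It is compatible with
passage to subchains, hence descends to a continuous map from the homotopy colimit to the geometric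
resolution (`Embeddings.comparison`). This map is itself a homeomorphism, and the theorem follows by
passing to one-point compactifications.

*Bijectivity.* Every point of the homotopy colimit lying over `x` is represented over the
one-element chain given by the set of all subspaces through `x` (`exists_hocolimMk_fullFace`). The
simplices `V(x)` are disjoint, so `x` can be recovered from the image point, and the images of `x`
are affinely independent, so the coordinates with respect to the vertices of `V(x)` can be recovered
as well. It remains to see that each point of a simplex is, in exactly one way, a convex combination
of barycenters of a chain of faces (`exists_vertexWeights_eq`, `eq_of_vertexWeights_eq`).

*Closedness.* The homotopy colimit is glued from finitely many pieces `Δ(P_{≤ x_t}) × D(x₁)`, where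
the order complex is compact. On each piece the map is a continuous family of affine maps
`D(x₁) → ℝᴺ` over a compact parameter space, and each of these is injective because the simplices
`V(x)` are disjoint. Compactness gives a uniform expansion factor, so the map on the piece is proper
(`isProperMap_of_affine_family`), in particular closed; no assumption on the behaviour of the
resolution at infinity is needed.

*Existence.* If each subspace `A` is embedded by `x ↦ (1, x)` into its own summand of
`⨁_A (ℝ × ℝⁿ)`, a point of `V(x)` has all its blocks proportional to `(1, x)` and not all of them
zero, so that it determines `x` (`Embeddings.isGeneric_blockEmbedding`).
-/

/-! ### Barycentric subdivision of a simplex -/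

namespace VassilievModel

section Barycentric

variable {ι : Type*} [DecidableEq ι]

/-- The barycentric coordinates, with respect to the vertices, of the combination with
coefficients `w` of the barycenters of the faces of a simplex with vertex set `ι`. -/
noncomputable def vertexWeights (w : Finset ι →₀ ℝ) (i : ι) : ℝ :=
  w.sum fun τ t => if i ∈ τ then t / τ.card else 0

theorem vertexWeights_eq_sum {w : Finset ι →₀ ℝ} {S : Finset (Finset ι)} (h : w.support ⊆ S)
    (i : ι) : vertexWeights w i = ∑ τ ∈ S, if i ∈ τ then w τ / τ.card else 0 :=
  Finsupp.sum_of_support_subset _ h _ (by simp)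

theorem vertexWeights_add_single (w : Finset ι →₀ ℝ) (τ : Finset ι) (t : ℝ) (i : ι) :
    vertexWeights (w + Finsupp.single τ t) i =
      vertexWeights w i + if i ∈ τ then t / τ.card else 0 := by
  unfold vertexWeights
  rw [Finsupp.sum_add_index' (by simp), Finsupp.sum_single_index (by simp)]
  intro σ a b
  split_ifs <;> ring

theorem vertexWeights_eq_zero {w : Finset ι →₀ ℝ} {i : ι} (h : ∀ τ ∈ w.support, i ∉ τ) :
    vertexWeights w i = 0 :=
  Finset.sum_eq_zero fun τ hτ => if_neg (h τ hτ)

theorem sum_vertexWeights {w : Finset ι →₀ ℝ} {s : Finset ι}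
    (h : ∀ τ ∈ w.support, τ.Nonempty ∧ τ ⊆ s) :
    ∑ i ∈ s, vertexWeights w i = w.sum fun _ t => t := by
  unfold vertexWeights Finsupp.sum
  rw [Finset.sum_comm]
  refine Finset.sum_congr rfl fun τ hτ => ?_
  have hc : (τ.card : ℝ) ≠ 0 := by exact_mod_cast (h τ hτ).1.card_ne_zero
  rw [Finset.sum_ite_mem, Finset.inter_eq_right.2 (h τ hτ).2, Finset.sum_const, nsmul_eq_mul]
  field_simp

/-- The comparison step for uniqueness of the coefficients with respect to barycenters: if the
coefficients `v` are supported on a chain, some vertex of `τ` lies in no other face in the support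
of `v` of size at most that of `τ`, and its coordinate detects the coefficient of `τ`. -/
theorem le_of_vertexWeights_eq {u v : Finset ι →₀ ℝ} (hu : ∀ τ, 0 ≤ u τ)
    (hv : IsChain (· ≤ ·) (v.support : Set (Finset ι)))
    (h : vertexWeights u = vertexWeights v) {τ : Finset ι} (hτ : τ.Nonempty)
    (hgt : ∀ σ : Finset ι, τ.card < σ.card → u σ = v σ) : u τ ≤ v τ := by
  obtain ⟨j, hj, hjv⟩ : ∃ j ∈ τ, ∀ σ ∈ v.support, σ.card ≤ τ.card → σ ≠ τ → j ∉ σ := by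
    rcases (v.support.filter fun σ => σ.card ≤ τ.card ∧ σ ≠ τ).eq_empty_or_nonempty with h0 | h0
    · obtain ⟨j, hj⟩ := hτ
      refine ⟨j, hj, fun σ hσ h1 h2 => ?_⟩
      have : σ ∈ (∅ : Finset (Finset ι)) := h0 ▸ Finset.mem_filter.2 ⟨hσ, h1, h2⟩
      simp at this
    · obtain ⟨ρ, hρ⟩ := Finset.exists_maximal h0
      obtain ⟨hρv, hρc, hρτ⟩ := Finset.mem_filter.1 hρ.1
      have : ¬ τ ⊆ ρ := fun hs => hρτ (Finset.eq_of_subset_of_card_le hs hρc).symm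
      obtain ⟨j, hj, hjρ⟩ := Finset.not_subset.1 this
      refine ⟨j, hj, fun σ hσ h1 h2 hjσ => hjρ ?_⟩
      rcases hv.total hσ hρv with hle | hle
      · exact hle hjσ
      · exact hρ.2 (Finset.mem_filter.2 ⟨hσ, h1, h2⟩) hle hjσ
  by_contra! hlt
  have hc : (0 : ℝ) < τ.card := by exact_mod_cast hτ.card_pos
  have hS : u.support ⊆ insert τ (u.support ∪ v.support) :=
    fun σ hσ => Finset.mem_insert_of_mem (Finset.mem_union_left _ hσ)
  have hS' : v.support ⊆ insert τ (u.support ∪ v.support) :=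
    fun σ hσ => Finset.mem_insert_of_mem (Finset.mem_union_right _ hσ)
  have := congrFun h j
  rw [vertexWeights_eq_sum hS, vertexWeights_eq_sum hS'] at this
  refine this.not_gt (Finset.sum_lt_sum (fun σ _ => ?_) ⟨τ, Finset.mem_insert_self _ _, ?_⟩)
  · split_ifs with hjσ
    · by_cases hστ : σ = τ
      · subst hστ
        gcongr
      · by_cases hcard : τ.card < σ.card
        · rw [hgt σ hcard]
        · have : v σ = 0 := by
            by_contra h0
            exact hjv σ (Finsupp.mem_support_iff.2 h0) (not_lt.1 hcard) hστ hjσ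
          rw [this, zero_div]
          exact div_nonneg (hu σ) (Nat.cast_nonneg _)
    · exact le_rfl
  · rw [if_pos hj, if_pos hj]
    gcongr

/-- Coefficients with respect to the barycenters of a chain of faces are determined by the point
they describe. -/
theorem eq_of_vertexWeights_eq {u v : Finset ι →₀ ℝ} (hu : ∀ τ, 0 ≤ u τ) (hv : ∀ τ, 0 ≤ v τ)
    (hu' : IsChain (· ≤ ·) (u.support : Set (Finset ι)))
    (hv' : IsChain (· ≤ ·) (v.support : Set (Finset ι)))
    (hu0 : u ∅ = 0) (hv0 : v ∅ = 0)
    (h : vertexWeights u = vertexWeights v) : u = v := by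
  by_contra hne
  have hD : ((u.support ∪ v.support).filter fun τ => u τ ≠ v τ).Nonempty := by
    obtain ⟨τ, hτ⟩ := DFunLike.ne_iff.1 hne
    refine ⟨τ, Finset.mem_filter.2 ⟨?_, hτ⟩⟩
    by_contra hmem
    simp only [Finset.mem_union, Finsupp.mem_support_iff, not_or, not_not] at hmem
    exact hτ (hmem.1.trans hmem.2.symm)
  -- the largest face at which the coefficients differ
  obtain ⟨τ, hτ, hmax⟩ := Finset.exists_max_image _ Finset.card hD
  have hτne := (Finset.mem_filter.1 hτ).2
  have hgt : ∀ σ : Finset ι, τ.card < σ.card → u σ = v σ := by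
    intro σ hσ
    by_contra hσne
    refine hσ.not_ge (hmax σ (Finset.mem_filter.2 ⟨?_, hσne⟩))
    by_contra hmem
    simp only [Finset.mem_union, Finsupp.mem_support_iff, not_or, not_not] at hmem
    exact hσne (hmem.1.trans hmem.2.symm)
  have hτ0 : τ.Nonempty := by
    rw [Finset.nonempty_iff_ne_empty]
    rintro rfl
    exact hτne (hu0.trans hv0.symm)
  exact hτne (le_antisymm (le_of_vertexWeights_eq hu hv' h hτ0 hgt)
    (le_of_vertexWeights_eq hv hu' h.symm hτ0 fun σ hσ => (hgt σ hσ).symm))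

/-- Every nonnegative weight on the vertices is a nonnegative combination of barycenters of a
chain of faces: split off the constant function of largest possible value on the support and
continue with the rest, which has smaller support. -/
theorem exists_vertexWeights_eq (s : Finset ι) (l : ι → ℝ) (hpos : ∀ i ∈ s, 0 < l i)
    (hzero : ∀ i ∉ s, l i = 0) :
    ∃ w : Finset ι →₀ ℝ, (∀ τ, 0 ≤ w τ) ∧ IsChain (· ≤ ·) (w.support : Set (Finset ι)) ∧
      (∀ τ ∈ w.support, τ.Nonempty ∧ τ ⊆ s) ∧ vertexWeights w = l := by
  induction s using Finset.strongInduction generalizing l with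
  | H s ih =>
    rcases s.eq_empty_or_nonempty with rfl | hs
    · refine ⟨0, by simp, by simp, by simp, ?_⟩
      funext i
      rw [hzero i (by simp)]
      rfl
    obtain ⟨i₀, hi₀, hmin⟩ := s.exists_min_image l hs
    have hss : s.filter (fun i => l i₀ < l i) ⊂ s := by
      refine Finset.filter_ssubset.2 ⟨i₀, hi₀, lt_irrefl _⟩
    obtain ⟨w, hw0, hwc, hws, hwl⟩ := ih _ hss (fun i => if i ∈ s then l i - l i₀ else 0)
      (fun i hi => by
        rw [Finset.mem_filter] at hi
        rw [if_pos hi.1]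
        linarith [hi.2])
      (fun i hi => by
        split_ifs with his
        · have : ¬ l i₀ < l i := fun hlt => hi (Finset.mem_filter.2 ⟨his, hlt⟩)
          linarith [hmin i his]
        · rfl)
    have hc : (0 : ℝ) < s.card := by exact_mod_cast hs.card_pos
    have hsupp : (w + Finsupp.single s (l i₀ * s.card)).support ⊆ insert s w.support := by
      refine Finsupp.support_add.trans ?_
      refine Finset.union_subset (Finset.subset_insert _ _) ?_
      exact Finsupp.support_single_subset.trans (by simp)
    refine ⟨w + Finsupp.single s (l i₀ * s.card), fun τ => ?_, ?_, fun τ hτ => ?_, ?_⟩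
    · refine add_nonneg (hw0 τ) ?_
      rw [Finsupp.single_apply]
      split_ifs
      · exact mul_nonneg (hpos _ hi₀).le hc.le
      · exact le_rfl
    · refine IsChain.mono (Finset.coe_subset.2 hsupp) ?_
      rw [Finset.coe_insert]
      exact hwc.insert fun τ hτ _ => Or.inr ((hws τ hτ).2.trans hss.subset)
    · rcases Finset.mem_insert.1 (hsupp hτ) with rfl | hτ
      · exact ⟨hs, subset_rfl⟩
      · exact ⟨(hws τ hτ).1, (hws τ hτ).2.trans hss.subset⟩
    · funext i
      rw [vertexWeights_add_single, hwl, mul_div_cancel_right₀ _ hc.ne']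
      by_cases his : i ∈ s
      · simp [his]
      · simp [his, hzero i his]

end Barycentric

/-! ### Realizations of finite complexes -/

section Realization

universe u

variable {ι : Type u} {K : PreAbstractSimplicialComplex ι}

theorem ClosedSimplex.continuous_incl (s : K.faces) :
    Continuous (ClosedSimplex.incl : ClosedSimplex K s.1 → Realization K) := by
  rw [continuous_iff_coinduced_le]
  exact le_iSup (fun t : K.faces => TopologicalSpace.coinduced
    (ClosedSimplex.incl : ClosedSimplex K t.1 → Realization K) inferInstance) s

theorem Realization.continuous_apply (i : ι) : Continuous fun w : Realization K => w.1 i := by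
  rw [continuous_iSup_dom]
  intro s
  rw [continuous_coinduced_dom]
  exact (_root_.continuous_apply i).comp continuous_induced_dom

instance (s : K.faces) : CompactSpace (ClosedSimplex K s.1) := by
  have hind : Topology.IsInducing (fun w : ClosedSimplex K s.1 => (w.1.1 : ι → ℝ)) := ⟨rfl⟩
  rw [← isCompact_univ_iff, hind.isCompact_iff, Set.image_univ]
  have hrange : Set.range (fun w : ClosedSimplex K s.1 => (w.1.1 : ι → ℝ)) =
      (Set.univ.pi fun _ => Set.Icc (0 : ℝ) 1) ∩
        ({f | ∑ i ∈ s.1, f i = 1} ∩ ⋂ i ∈ {i | i ∉ s.1}, {f : ι → ℝ | f i = 0}) := by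
    ext f
    constructor
    · rintro ⟨w, rfl⟩
      have hsum : ∑ i ∈ s.1, w.1.1 i = 1 := by
        exact (Finsupp.sum_of_support_subset _ w.2 _ (by simp)).symm.trans w.1.2.2.1
      have hz : ∀ i ∉ s.1, w.1.1 i = 0 := fun i hi =>
        Finsupp.notMem_support_iff.1 fun h => hi (w.2 h)
      refine ⟨fun i _ => ⟨w.1.2.1 i, ?_⟩, hsum, by simpa using hz⟩
      by_cases hi : i ∈ s.1
      · refine le_of_le_of_eq ?_ hsum
        exact Finset.single_le_sum (f := fun i => w.1.1 i) (fun j _ => w.1.2.1 j) hi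
      · change w.1.1 i ≤ 1
        rw [hz i hi]
        exact zero_le_one
    · rintro ⟨h01, hsum, hz⟩
      simp only [Set.mem_iInter, Set.mem_ofPred_eq] at hz hsum
      have hsupp : ∀ i, f i ≠ 0 → i ∈ s.1 := fun i hi => by
        by_contra h
        exact hi (hz i h)
      let w : ι →₀ ℝ := Finsupp.onFinset s.1 f hsupp
      have hw : w.support ⊆ s.1 := Finsupp.support_onFinset_subset
      have hsum' : (w.sum fun _ t => t) = 1 := by
        rw [Finsupp.sum_of_support_subset _ hw _ (by simp)]
        exact hsum
      refine ⟨⟨⟨w, fun i => (h01 i trivial).1, hsum',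
        (K.isRelLowerSet_faces s.2).2 hw ?_⟩, hw⟩, rfl⟩
      rw [Finset.nonempty_iff_ne_empty]
      intro h
      rw [Finsupp.support_eq_empty] at h
      simp [h] at hsum'
  rw [hrange]
  refine (isCompact_univ_pi fun _ => isCompact_Icc).inter_right (IsClosed.inter ?_ ?_)
  · exact isClosed_eq (by fun_prop) continuous_const
  · exact isClosed_biInter fun i _ => isClosed_eq (by fun_prop) continuous_const

instance [Finite ι] : CompactSpace (Realization K) := by
  rw [← isCompact_univ_iff]
  have : (Set.univ : Set (Realization K)) = ⋃ s : K.faces,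
      Set.range (ClosedSimplex.incl : ClosedSimplex K s.1 → Realization K) := by
    refine (Set.eq_univ_of_forall fun w => Set.mem_iUnion.2 ?_).symm
    exact ⟨⟨_, w.2.2.2⟩, ⟨w, subset_rfl⟩, rfl⟩
  rw [this]
  exact isCompact_iUnion fun s => isCompact_range (ClosedSimplex.continuous_incl s)

end Realization

/-! ### Families of affine embeddings over a compact base -/

/-- A continuous family, over a compact parameter space, of affine maps that are injective on an
affine subspace `B` is proper on `B`: by compactness the maps expand distances from a base point by
a factor bounded below on the unit sphere, hence by affinity everywhere. -/
theorem isProperMap_of_affine_family {K V W : Type*} [TopologicalSpace K] [CompactSpace K]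
    [NormedAddCommGroup V] [NormedSpace ℝ V] [FiniteDimensional ℝ V]
    [NormedAddCommGroup W] [NormedSpace ℝ W] [FiniteDimensional ℝ W]
    (B : AffineSubspace ℝ V) (f : K → V →ᵃ[ℝ] W)
    (hf : Continuous fun p : K × V => f p.1 p.2) (hinj : ∀ w, Set.InjOn (f w) B) :
    IsProperMap fun p : K × B => f p.1 p.2 := by
  have hcont : Continuous fun p : K × B => f p.1 p.2 :=
    hf.comp (continuous_fst.prodMk (continuous_subtype_val.comp continuous_snd))
  rw [isProperMap_iff_isCompact_preimage]
  refine ⟨hcont, fun C hC => ?_⟩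
  rcases isEmpty_or_nonempty B with hB | ⟨⟨x₀, hx₀⟩⟩
  · convert isCompact_empty
    exact Set.eq_empty_of_isEmpty _
  have hBclosed : IsClosed (B : Set V) := B.closed_of_finiteDimensional
  have hg : Continuous fun p : K × V => ‖f p.1 p.2 - f p.1 x₀‖ :=
    (hf.sub (hf.comp (continuous_fst.prodMk continuous_const))).norm
  obtain ⟨δ, hδ, hexp⟩ : ∃ δ > 0, ∀ w, ∀ x ∈ B, ‖x - x₀‖ = 1 → δ ≤ ‖f w x - f w x₀‖ := by
    have hS : IsCompact ((Set.univ : Set K) ×ˢ ((B : Set V) ∩ Metric.sphere x₀ 1)) :=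
      isCompact_univ.prod ((isCompact_sphere x₀ 1).inter_left hBclosed)
    rcases (((Set.univ : Set K) ×ˢ ((B : Set V) ∩ Metric.sphere x₀ 1))).eq_empty_or_nonempty
      with h0 | h0
    · refine ⟨1, one_pos, fun w x hx hx1 => ?_⟩
      have : (w, x) ∈ (∅ : Set (K × V)) := h0 ▸ ⟨trivial, hx, by simpa [dist_eq_norm] using hx1⟩
      exact this.elim
    · obtain ⟨⟨w, x⟩, ⟨-, hx, hx1⟩, hmin⟩ := hS.exists_isMinOn h0 hg.continuousOn
      refine ⟨‖f w x - f w x₀‖, ?_, fun w' x' hx' hx1' => ?_⟩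
      · rw [gt_iff_lt, norm_pos_iff, sub_ne_zero]
        intro h
        rw [hinj w hx hx₀ h] at hx1
        simp at hx1
      · exact hmin (a := (w', x')) ⟨trivial, hx', by simpa [dist_eq_norm] using hx1'⟩
  have hexp' : ∀ w, ∀ x ∈ B, δ * ‖x - x₀‖ ≤ ‖f w x - f w x₀‖ := by
    intro w x hx
    rcases eq_or_ne x x₀ with rfl | hne
    · simp
    have hr : 0 < ‖x - x₀‖ := norm_pos_iff.2 (sub_ne_zero.2 hne)
    have h1 := hexp w (AffineMap.lineMap x₀ x (‖x - x₀‖⁻¹)) (AffineMap.lineMap_mem _ hx₀ hx) (by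
      rw [AffineMap.lineMap_apply, vsub_eq_sub, vadd_eq_add, add_sub_cancel_right, norm_smul,
        norm_inv, norm_norm, inv_mul_cancel₀ hr.ne'])
    rw [AffineMap.apply_lineMap, AffineMap.lineMap_apply, vsub_eq_sub, vadd_eq_add,
      add_sub_cancel_right, norm_smul, norm_inv, norm_norm] at h1
    rw [inv_mul_eq_div, le_div_iff₀ hr] at h1
    exact h1
  obtain ⟨R, hR⟩ := hC.isBounded.exists_norm_le
  obtain ⟨R', hR'⟩ : ∃ R', ∀ w, ‖f w x₀‖ ≤ R' := by
    have : Continuous fun w => f w x₀ := hf.comp (continuous_id.prodMk continuous_const)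
    obtain ⟨R', hR'⟩ := (isCompact_range this).isBounded.exists_norm_le
    exact ⟨R', fun w => hR' _ ⟨w, rfl⟩⟩
  have hemb : Topology.IsClosedEmbedding (Subtype.val : B → V) :=
    hBclosed.isClosedEmbedding_subtypeVal
  have hball : IsCompact ((Set.univ : Set K) ×ˢ
      ((Subtype.val : B → V) ⁻¹' Metric.closedBall x₀ ((R + R') / δ))) :=
    isCompact_univ.prod (hemb.isCompact_preimage (isCompact_closedBall _ _))
  refine hball.of_isClosed_subset (hC.isClosed.preimage hcont) ?_
  rintro ⟨w, x, hx⟩ hwx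
  refine ⟨trivial, ?_⟩
  simp only [Set.mem_preimage, Metric.mem_closedBall, dist_eq_norm]
  rw [le_div_iff₀ hδ, mul_comm]
  calc δ * ‖x - x₀‖ ≤ ‖f w x - f w x₀‖ := hexp' w x hx
    _ ≤ ‖f w x‖ + ‖f w x₀‖ := norm_sub_le _ _
    _ ≤ R + R' := add_le_add (hR _ hwx) (hR' w)

end VassilievModel

/-! ### Affine maps and convex hulls -/

namespace VassilievModel

theorem exists_affineMap_extension {V W : Type*} [AddCommGroup V] [Module ℝ V] [AddCommGroup W]
    [Module ℝ W] (B : AffineSubspace ℝ V) [Nonempty B] (f : B →ᵃ[ℝ] W) :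
    ∃ g : V →ᵃ[ℝ] W, ∀ x : B, g x = f x := by
  obtain ⟨L, hL⟩ := f.linear.exists_extend
  obtain ⟨x₀⟩ := ‹Nonempty B›
  refine ⟨L.toAffineMap + AffineMap.const ℝ V (f x₀ - L x₀), fun x => ?_⟩
  have h1 : f x = f.linear (x -ᵥ x₀) + f x₀ := by
    rw [AffineMap.linearMap_vsub, vsub_eq_sub, sub_add_cancel]
  have h2 : f.linear (x -ᵥ x₀) = L (x.1 - x₀.1) := by
    rw [← hL]
    rfl
  rw [h1, h2, map_sub]
  simp only [AffineMap.coe_add, Pi.add_apply, LinearMap.coe_toAffineMap, AffineMap.const_apply]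
  abel

theorem exists_weights_of_mem_convexHull_image {ι V : Type*} [AddCommGroup V] [Module ℝ V]
    (s : Finset ι) (v : ι → V) {p : V} (hp : p ∈ convexHull ℝ (v '' s)) :
    ∃ l : ι → ℝ, (∀ i, 0 ≤ l i) ∧ (∀ i ∉ s, l i = 0) ∧ ∑ i ∈ s, l i = 1 ∧
      ∑ i ∈ s, l i • v i = p := by
  classical
  let S : Set V := {p | ∃ l : ι → ℝ, (∀ i, 0 ≤ l i) ∧ (∀ i ∉ s, l i = 0) ∧ ∑ i ∈ s, l i = 1 ∧
      ∑ i ∈ s, l i • v i = p}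
  have hS : Convex ℝ S := by
    rintro _ ⟨l, h0, hz, h1, rfl⟩ _ ⟨l', h0', hz', h1', rfl⟩ a b ha hb hab
    refine ⟨fun i => a * l i + b * l' i, fun i => ?_, fun i hi => ?_, ?_, ?_⟩
    · exact add_nonneg (mul_nonneg ha (h0 i)) (mul_nonneg hb (h0' i))
    · simp [hz i hi, hz' i hi]
    · rw [Finset.sum_add_distrib, ← Finset.mul_sum, ← Finset.mul_sum, h1, h1', mul_one, mul_one,
        hab]
    · simp only [add_smul, mul_smul, Finset.sum_add_distrib, Finset.smul_sum]
  refine convexHull_min ?_ hS hp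
  rintro _ ⟨j, hj, rfl⟩
  have hj : j ∈ s := hj
  refine ⟨fun i => if i = j then 1 else 0, fun i => ?_, fun i hi => ?_, ?_, ?_⟩
  · dsimp only
    split_ifs <;> norm_num
  · exact if_neg (by rintro rfl; exact hi hj)
  · simp [hj]
  · simp [hj]

/-! ### Vertices and faces of the nerve -/

namespace SubspaceArrangement

variable {n : ℕ} {𝒜 : SubspaceArrangement n}

variable (𝒜) in
/-- The vertices of the nerve of an arrangement: the minimal elements of the intersection
semilattice. -/
abbrev Vertex : Type := {a : 𝒜.IntersectionSemilattice // IsMin a}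

/-- The subspace of the arrangement corresponding to a vertex of the nerve. -/
def Vertex.subspace (a : 𝒜.Vertex) : 𝒜.subspaces :=
  ⟨a.1.space, (IntersectionSemilattice.isMin_iff _).1 a.2⟩

theorem Vertex.subspace_injective : Function.Injective (Vertex.subspace (𝒜 := 𝒜)) :=
  fun _ _ h => Subtype.ext (Subtype.ext (congrArg (fun A : 𝒜.subspaces => A.1) h))

theorem Vertex.subspace_surjective : Function.Surjective (Vertex.subspace (𝒜 := 𝒜)) := by
  rintro ⟨A, hA⟩
  let a : 𝒜.IntersectionSemilattice :=
    ⟨OrderDual.toDual A, 𝒜.nonempty A hA, {A}, by simpa using hA, by simp, by simp⟩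
  exact ⟨⟨a, (IntersectionSemilattice.isMin_iff a).2 hA⟩, rfl⟩

noncomputable instance : DecidableEq 𝒜.Vertex := Classical.decEq _

noncomputable instance : Fintype 𝒜.Vertex :=
  Fintype.ofInjective Vertex.subspace Vertex.subspace_injective

open Classical in
/-- The largest face of the nerve whose intersection contains `x`: all subspaces through `x`. -/
noncomputable def fullFace (x : E n) (hx : x ∈ 𝒜.union) : FacePoset 𝒜.nerve :=
  ⟨Finset.univ.filter fun a : 𝒜.Vertex => x ∈ a.1.space, by
    have hne : (Finset.univ.filter fun a : 𝒜.Vertex => x ∈ a.1.space).Nonempty := by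
      simp only [union, Set.mem_iUnion] at hx
      obtain ⟨A, hA, hxA⟩ := hx
      obtain ⟨a, ha⟩ := Vertex.subspace_surjective (𝒜 := 𝒜) ⟨A, hA⟩
      refine ⟨a, Finset.mem_filter.2 ⟨Finset.mem_univ _, ?_⟩⟩
      have : a.1.space = A := congrArg Subtype.val ha
      rw [this]
      exact hxA
    refine ⟨hne, ?_⟩
    rw [← Finset.coe_image]
    refine exists_isLUB_of_bddAbove (hne.image _) ?_
    let S := (Finset.univ.filter fun a : 𝒜.Vertex => x ∈ a.1.space).image fun a => a.1.space
    refine ⟨⟨OrderDual.toDual (sInf (S : Set (AffineSubspace ℝ (E n)))), ⟨x, ?_⟩, S, ?_,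
      hne.image _, rfl⟩, ?_⟩
    · simp only [OrderDual.ofDual_toDual, AffineSubspace.coe_sInf, Set.mem_iInter]
      intro B hB
      obtain ⟨a, ha, rfl⟩ := Finset.mem_image.1 hB
      exact (Finset.mem_filter.1 ha).2
    · intro B hB
      obtain ⟨a, ha, rfl⟩ := Finset.mem_image.1 hB
      exact (Vertex.subspace a).2
    · intro y hy
      obtain ⟨a, ha, rfl⟩ := Finset.mem_image.1 hy
      exact (IntersectionSemilattice.le_iff _ _).2
        (sInf_le (Finset.mem_coe.2 (Finset.mem_image_of_mem _ ha)))⟩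

theorem mem_fullFace {x : E n} {hx : x ∈ 𝒜.union} {a : 𝒜.Vertex} :
    a ∈ (fullFace x hx).1 ↔ x ∈ a.1.space := by
  classical
  simp [fullFace]

theorem mem_union_of_face (σ : FacePoset 𝒜.nerve) {x : E n} (hx : ∀ a ∈ σ.1, x ∈ a.1.space) :
    x ∈ 𝒜.union := by
  obtain ⟨a, ha⟩ := σ.2.1
  exact Set.mem_biUnion (Vertex.subspace a).2 (hx a ha)

/-! ### Barycentric coordinates on order complexes of faces -/

variable {b : FacePoset 𝒜.nerve}

/-- The barycentric coordinates of a point of `Δ(P_{≤ b})`, as a function on all finite sets of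
vertices. This makes points for different `b` comparable. -/
noncomputable def flagWeights (w : OrderComplex (Set.Iic b)) : Finset 𝒜.Vertex →₀ ℝ :=
  w.1.mapDomain fun τ => τ.1.1

theorem injective_face : Function.Injective fun τ : Set.Iic b => (τ.1.1 : Finset 𝒜.Vertex) :=
  fun _ _ h => Subtype.ext (Subtype.ext h)

theorem flagWeights_injective :
    Function.Injective (flagWeights : OrderComplex (Set.Iic b) → Finset 𝒜.Vertex →₀ ℝ) :=
  fun _ _ h => Subtype.ext (Finsupp.mapDomain_injective injective_face h)

theorem flagWeights_inclusion {c : FacePoset 𝒜.nerve} (h : b ≤ c)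
    (w : OrderComplex (Set.Iic b)) : flagWeights (orderComplexInclusion h w) = flagWeights w := by
  rw [flagWeights, orderComplexInclusion_val, ← Finsupp.mapDomain_comp]
  rfl

theorem flagWeights_nonneg (w : OrderComplex (Set.Iic b)) (τ : Finset 𝒜.Vertex) :
    0 ≤ flagWeights w τ := by
  by_cases h : τ ∈ Set.range fun τ : Set.Iic b => (τ.1.1 : Finset 𝒜.Vertex)
  · obtain ⟨τ, rfl⟩ := h
    rw [flagWeights, Finsupp.mapDomain_apply injective_face]
    exact w.2.1 τ
  · rw [flagWeights, Finsupp.mapDomain_of_notMem_range _ _ h]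

theorem mem_support_flagWeights {w : OrderComplex (Set.Iic b)} {τ : Finset 𝒜.Vertex}
    (h : τ ∈ (flagWeights w).support) : ∃ ρ ∈ w.1.support, ρ.1.1 = τ :=
  Finset.mem_image.1 (Finsupp.mapDomain_support h)

theorem flagWeights_support (w : OrderComplex (Set.Iic b)) :
    ∀ τ ∈ (flagWeights w).support, τ.Nonempty ∧ τ ⊆ b.1 := by
  intro τ h
  obtain ⟨ρ, -, rfl⟩ := mem_support_flagWeights h
  exact ⟨ρ.1.2.1, ρ.2⟩

theorem flagWeights_empty (w : OrderComplex (Set.Iic b)) : flagWeights w ∅ = 0 := by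
  by_contra h
  exact Finset.not_nonempty_empty (flagWeights_support w _ (Finsupp.mem_support_iff.2 h)).1

theorem isChain_flagWeights (w : OrderComplex (Set.Iic b)) :
    IsChain (· ≤ ·) ((flagWeights w).support : Set (Finset 𝒜.Vertex)) := by
  intro τ hτ τ' hτ' _
  obtain ⟨ρ, hρ, rfl⟩ := mem_support_flagWeights hτ
  obtain ⟨ρ', hρ', rfl⟩ := mem_support_flagWeights hτ'
  exact w.2.2.2.2.total hρ hρ'

theorem flagWeights_sum (w : OrderComplex (Set.Iic b)) :
    ((flagWeights w).sum fun _ t => t) = 1 := by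
  rw [flagWeights, Finsupp.sum_mapDomain_index (by simp) (by simp)]
  exact w.2.2.1

/-- Coefficients supported on a chain of nonempty subsets of `b` come from a point of `Δ(P_{≤ b})`:
subsets of a face are faces. -/
theorem exists_flagWeights_eq (v : Finset 𝒜.Vertex →₀ ℝ) (h0 : ∀ τ, 0 ≤ v τ)
    (hc : IsChain (· ≤ ·) (v.support : Set (Finset 𝒜.Vertex)))
    (hs : ∀ τ ∈ v.support, τ.Nonempty ∧ τ ⊆ b.1) (h1 : (v.sum fun _ t => t) = 1) :
    ∃ w : OrderComplex (Set.Iic b), flagWeights w = v := by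
  let f : Set.Iic b → Finset 𝒜.Vertex := fun τ => τ.1.1
  let u : Set.Iic b →₀ ℝ := v.comapDomain f injective_face.injOn
  have hu : u.mapDomain f = v := by
    refine Finsupp.mapDomain_comapDomain _ injective_face _ fun τ hτ => ?_
    have hτ' := hs τ hτ
    exact ⟨⟨⟨τ, (𝒜.nerve.isRelLowerSet_faces b.2).2 hτ'.2 hτ'.1⟩, hτ'.2⟩, rfl⟩
  have hu1 : (u.sum fun _ t => t) = 1 := by
    rw [← h1, ← hu, Finsupp.sum_mapDomain_index (by simp) (by simp)]
  refine ⟨⟨u, fun τ => h0 _, hu1, ?_, ?_⟩, hu⟩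
  · rw [Finset.nonempty_iff_ne_empty]
    intro h
    rw [Finsupp.support_eq_empty] at h
    simp [h] at hu1
  · intro τ hτ τ' hτ' _
    have h : ∀ {ρ}, ρ ∈ u.support → f ρ ∈ v.support := fun hρ => by
      rwa [Finsupp.mem_support_iff] at hρ ⊢
    exact hc.total (h hτ) (h hτ')

theorem vertexWeights_flagWeights (w : OrderComplex (Set.Iic b)) (a : 𝒜.Vertex) :
    vertexWeights (flagWeights w) a =
      w.1.sum fun τ t => if a ∈ τ.1.1 then t / τ.1.1.card else 0 := by
  rw [vertexWeights, flagWeights, Finsupp.sum_mapDomain_index (by simp)]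
  intro τ s t
  split_ifs <;> ring

theorem continuous_vertexWeights (a : 𝒜.Vertex) :
    Continuous fun w : OrderComplex (Set.Iic b) => vertexWeights (flagWeights w) a := by
  cases nonempty_fintype (Set.Iic b)
  have h : (fun w : OrderComplex (Set.Iic b) => vertexWeights (flagWeights w) a) =
      fun w => ∑ τ, if a ∈ τ.1.1 then w.1 τ / (τ.1.1.card : ℝ) else 0 := funext fun w =>
    (vertexWeights_flagWeights w a).trans (Finsupp.sum_fintype _ _ fun τ => by simp)
  rw [h]
  refine continuous_finsetSum _ fun τ _ => ?_
  split_ifs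
  · exact (Realization.continuous_apply τ).div_const _
  · exact continuous_const

theorem vertexWeights_flagWeights_nonneg (w : OrderComplex (Set.Iic b)) (a : 𝒜.Vertex) :
    0 ≤ vertexWeights (flagWeights w) a :=
  Finset.sum_nonneg fun τ _ => by
    dsimp only
    split_ifs
    · exact div_nonneg (flagWeights_nonneg w τ) (Nat.cast_nonneg _)
    · exact le_rfl

/-! ### Points of the simplices over points of the union -/

namespace Embeddings

variable {N : ℕ} (e : 𝒜.Embeddings N)

/-- An affine extension to all of `ℝⁿ` of the embedding belonging to a vertex of the nerve. -/
noncomputable def extension (a : 𝒜.Vertex) : E n →ᵃ[ℝ] E N :=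
  (exists_affineMap_extension a.subspace.1 (e.toFun a.subspace)).choose

theorem extension_apply (a : 𝒜.Vertex) (x : E n) (hx : x ∈ a.1.space) :
    e.extension a x = e.toFun a.subspace ⟨x, hx⟩ :=
  (exists_affineMap_extension a.subspace.1 (e.toFun a.subspace)).choose_spec ⟨x, hx⟩

theorem barycenter_eq_sum (τ : FacePoset 𝒜.nerve) (x : E n) (hx : ∀ a ∈ τ.1, x ∈ a.1.space) :
    e.barycenter τ x hx = ∑ a ∈ τ.1, (1 / (τ.1.card : ℝ)) • e.extension a x := by
  have hne : (Finset.univ : Finset τ.1).Nonempty := by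
    obtain ⟨a, ha⟩ := τ.2.1
    exact ⟨⟨a, ha⟩, Finset.mem_univ _⟩
  rw [barycenter, Finset.centroid_def, Finset.affineCombination_eq_linear_combination _ _ _
    (Finset.sum_centroidWeights_eq_one_of_nonempty ℝ _ hne),
    ← Finset.sum_coe_sort τ.1 fun a => (1 / (τ.1.card : ℝ)) • e.extension a x]
  refine Finset.sum_congr rfl fun a _ => ?_
  rw [Finset.centroidWeights_apply, Finset.card_univ, Fintype.card_coe, one_div,
    e.extension_apply a.1 x (hx a.1 a.2)]
  rfl

/-- A point of the subdivision in terms of the vertices of the simplex over `x`. -/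
theorem subdivisionPoint_eq_sum (c : Bd (FacePoset 𝒜.nerve))
    (w : OrderComplex (Set.Iic (chainBot c))) (x : 𝒜.vassilievDiagram.obj (op (chainTop c))) :
    e.subdivisionPoint c w x =
      ∑ a ∈ (chainTop c).1, vertexWeights (flagWeights w) a • e.extension a x.1 := by
  simp_rw [vertexWeights_flagWeights]
  unfold subdivisionPoint Finsupp.sum
  simp_rw [Finset.sum_smul]
  rw [Finset.sum_comm]
  refine Finset.sum_congr rfl fun τ _ => ?_
  have hle : τ.1.1 ⊆ (chainTop c).1 := τ.2.trans (chainBot_le_chainTop c)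
  rw [barycenter_eq_sum, Finset.smul_sum]
  simp_rw [ite_smul, zero_smul]
  rw [Finset.sum_ite_mem, Finset.inter_eq_right.2 hle]
  refine Finset.sum_congr rfl fun a _ => ?_
  rw [smul_smul, mul_one_div]

theorem extension_image_fullFace (x : E n) (hx : x ∈ 𝒜.union) :
    (fun a => e.extension a x) '' (fullFace x hx).1 = Set.range (e.images x) := by
  ext p
  constructor
  · rintro ⟨a, ha, rfl⟩
    have hxa := mem_fullFace.1 ha
    exact ⟨⟨a.subspace, hxa⟩, (e.extension_apply a x hxa).symm⟩
  · rintro ⟨⟨A, hA⟩, rfl⟩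
    obtain ⟨a, rfl⟩ := Vertex.subspace_surjective A
    exact ⟨a, mem_fullFace.2 hA, e.extension_apply a x hA⟩

/-- A point of the subdivision as an affine function of the point of `ℝⁿ`. -/
noncomputable def subdivisionAffine (c : Bd (FacePoset 𝒜.nerve))
    (w : OrderComplex (Set.Iic (chainBot c))) : E n →ᵃ[ℝ] E N :=
  ∑ a ∈ (chainTop c).1, vertexWeights (flagWeights w) a • e.extension a

theorem subdivisionAffine_apply (c : Bd (FacePoset 𝒜.nerve))
    (w : OrderComplex (Set.Iic (chainBot c))) (x : E n) :
    e.subdivisionAffine c w x =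
      ∑ a ∈ (chainTop c).1, vertexWeights (flagWeights w) a • e.extension a x := by
  unfold subdivisionAffine
  induction (chainTop c).1 using Finset.induction_on with
  | empty => simp
  | insert a s ha ih => rw [Finset.sum_insert ha, Finset.sum_insert ha, ← ih]; rfl

theorem subdivisionAffine_eq (c : Bd (FacePoset 𝒜.nerve))
    (w : OrderComplex (Set.Iic (chainBot c))) (x : 𝒜.vassilievDiagram.obj (op (chainTop c))) :
    e.subdivisionAffine c w x.1 = e.subdivisionPoint c w x :=
  (e.subdivisionAffine_apply c w x.1).trans (e.subdivisionPoint_eq_sum c w x).symm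

theorem subdivisionAffine_mem_simplexOver (c : Bd (FacePoset 𝒜.nerve))
    (w : OrderComplex (Set.Iic (chainBot c))) (x : E n)
    (hx : ∀ a ∈ (chainTop c).1, x ∈ a.1.space) :
    e.subdivisionAffine c w x ∈ e.simplexOver x := by
  rw [subdivisionAffine_apply]
  refine (convex_convexHull ℝ _).sum_mem (fun a _ => vertexWeights_flagWeights_nonneg w a) ?_
    fun a ha => subset_convexHull ℝ _ ?_
  · rw [sum_vertexWeights, flagWeights_sum]
    exact fun τ hτ => ⟨(flagWeights_support w τ hτ).1,
      (flagWeights_support w τ hτ).2.trans (chainBot_le_chainTop c)⟩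
  · exact ⟨⟨Vertex.subspace a, hx a ha⟩, (e.extension_apply a x (hx a ha)).symm⟩

theorem subdivisionPoint_mem_simplexOver (c : Bd (FacePoset 𝒜.nerve))
    (w : OrderComplex (Set.Iic (chainBot c))) (x : 𝒜.vassilievDiagram.obj (op (chainTop c))) :
    e.subdivisionPoint c w x ∈ e.simplexOver x.1 := by
  rw [← subdivisionAffine_eq]
  exact e.subdivisionAffine_mem_simplexOver c w x.1 x.2

theorem subdivisionPoint_mem_resolution (c : Bd (FacePoset 𝒜.nerve))
    (w : OrderComplex (Set.Iic (chainBot c))) (x : 𝒜.vassilievDiagram.obj (op (chainTop c))) :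
    e.subdivisionPoint c w x ∈ e.resolution :=
  Set.mem_biUnion (mem_union_of_face _ x.2) (e.subdivisionPoint_mem_simplexOver c w x)

variable {e}

theorem IsGeneric.affineIndependent_extension (he : e.IsGeneric) (x : E n) (hx : x ∈ 𝒜.union) :
    AffineIndependent ℝ fun a : (fullFace x hx).1 => e.extension a.1 x := by
  let φ : (fullFace x hx).1 ↪ {A : 𝒜.subspaces // x ∈ A.1} :=
    ⟨fun a => ⟨Vertex.subspace a.1, mem_fullFace.1 a.2⟩, fun a a' h =>
      Subtype.ext (Vertex.subspace_injective (congrArg Subtype.val h))⟩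
  convert (he.affineIndependent x hx).comp_embedding φ using 1
  funext a
  exact e.extension_apply a.1 x (mem_fullFace.1 a.2)

theorem IsGeneric.eq_of_mem_simplexOver (he : e.IsGeneric) {x y : E n} (hx : x ∈ 𝒜.union)
    (hy : y ∈ 𝒜.union) {p : E N} (hpx : p ∈ e.simplexOver x) (hpy : p ∈ e.simplexOver y) :
    x = y := by
  by_contra hne
  exact Set.disjoint_left.1 (he.disjoint x hx y hy hne) hpx hpy

/-- For a generic system and a fixed point of the union, a point of the subdivided simplex is
determined by its image. -/
theorem IsGeneric.subdivisionPoint_injective (he : e.IsGeneric) {c : Bd (FacePoset 𝒜.nerve)}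
    (w w' : OrderComplex (Set.Iic (chainBot c))) (x : 𝒜.vassilievDiagram.obj (op (chainTop c)))
    (h : e.subdivisionPoint c w x = e.subdivisionPoint c w' x) : w = w' := by
  have hx : x.1 ∈ 𝒜.union := mem_union_of_face _ x.2
  have hsub : (chainTop c).1 ⊆ (fullFace x.1 hx).1 := fun a ha => mem_fullFace.2 (x.2 a ha)
  have hsupp : ∀ v : OrderComplex (Set.Iic (chainBot c)), ∀ τ ∈ (flagWeights v).support,
      τ.Nonempty ∧ τ ⊆ (chainTop c).1 := fun v τ hτ =>
    ⟨(flagWeights_support v τ hτ).1, (flagWeights_support v τ hτ).2.trans (chainBot_le_chainTop c)⟩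
  have hz : ∀ v : OrderComplex (Set.Iic (chainBot c)), ∀ a ∉ (chainTop c).1,
      vertexWeights (flagWeights v) a = 0 := fun v a ha =>
    vertexWeights_eq_zero fun τ hτ haτ => ha ((hsupp v τ hτ).2 haτ)
  have hind := (he.affineIndependent_extension x.1 hx).comp_embedding
    ⟨fun a : (chainTop c).1 => (⟨a.1, hsub a.2⟩ : (fullFace x.1 hx).1),
      fun a a' h => Subtype.ext (congrArg (fun z => z.1) h)⟩
  have key : ∀ a : (chainTop c).1, a ∈ Finset.univ →
      vertexWeights (flagWeights w) a.1 = vertexWeights (flagWeights w') a.1 := by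
    refine hind.eq_of_sum_eq_sum ?_ ?_
    · rw [Finset.sum_coe_sort (chainTop c).1, Finset.sum_coe_sort (chainTop c).1,
        sum_vertexWeights (hsupp w), sum_vertexWeights (hsupp w'), flagWeights_sum,
        flagWeights_sum]
    · rw [subdivisionPoint_eq_sum, subdivisionPoint_eq_sum, ← Finset.sum_coe_sort,
        ← Finset.sum_coe_sort (chainTop c).1] at h
      exact h
  refine flagWeights_injective (eq_of_vertexWeights_eq (flagWeights_nonneg w)
    (flagWeights_nonneg w') (isChain_flagWeights w) (isChain_flagWeights w') (flagWeights_empty w)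
    (flagWeights_empty w') (funext fun a => ?_))
  by_cases ha : a ∈ (chainTop c).1
  · exact key ⟨a, ha⟩ (Finset.mem_univ _)
  · rw [hz w a ha, hz w' a ha]

end Embeddings

end SubspaceArrangement

end VassilievModel

/-! ### Homotopy colimits -/

namespace VassilievModel

section Hocolim

universe u

variable {P : Type u} [PartialOrder P] (D : Pᵒᵖ ⥤ TopCat.{u})

/-- The chain with the single element `p`. -/
def singletonChain (p : P) : Bd P where
  finset := {p}
  nonempty := Finset.singleton_nonempty p
  comparable := by
    rintro ⟨a, ha⟩ ⟨b, hb⟩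
    rw [Finset.mem_singleton] at ha hb
    subst ha hb
    exact Or.inl le_rfl

theorem chainTop_singletonChain (p : P) : chainTop (singletonChain p) = p :=
  Finset.mem_singleton.1 (isGreatest_chainTop (singletonChain p)).1

theorem chainBot_singletonChain (p : P) : chainBot (singletonChain p) = p :=
  Finset.mem_singleton.1 (isLeast_chainBot (singletonChain p)).1

/-- Adding an element `p` above a chain changes its largest element to `p` and keeps the smallest
one. -/
theorem exists_chain_above (c : Bd P) {p : P} (h : chainTop c ≤ p) :
    ∃ d : Bd P, c ≤ d ∧ singletonChain p ≤ d ∧ chainTop d = p ∧ chainBot d = chainBot c := by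
  classical
  have hle : ∀ q ∈ c.finset, q ≤ p := fun q hq => ((isGreatest_chainTop c).2 hq).trans h
  let d : Bd P :=
    { finset := insert p c.finset
      nonempty := Finset.insert_nonempty _ _
      comparable := by
        rintro ⟨a, ha⟩ ⟨b, hb⟩
        rcases Finset.mem_insert.1 ha with rfl | ha' <;> rcases Finset.mem_insert.1 hb with rfl | hb'
        · exact Or.inl le_rfl
        · exact Or.inr (hle b hb')
        · exact Or.inl (hle a ha')
        · exact c.comparable ⟨a, ha'⟩ ⟨b, hb'⟩ }
  have hcd : c ≤ d := Finset.subset_insert _ _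
  refine ⟨d, hcd, Finset.singleton_subset_iff.2 (Finset.mem_insert_self _ _), ?_, ?_⟩
  · refine le_antisymm ?_ ((isGreatest_chainTop d).2 (Finset.mem_insert_self _ _))
    rcases Finset.mem_insert.1 (isGreatest_chainTop d).1 with h1 | h1
    · exact h1.le
    · exact hle _ h1
  · refine le_antisymm (chainBot_anti hcd) ?_
    rcases Finset.mem_insert.1 (isLeast_chainBot d).1 with h1 | h1
    · exact ((chainBot_le_chainTop c).trans h).trans h1.ge
    · exact (isLeast_chainBot c).2 h1

theorem hocolimMk_map {c d : Bd P} (h : d ≤ c) (w : OrderComplex (Set.Iic (chainBot c)))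
    (x : D.obj (op (chainTop c))) :
    hocolimMk D d (orderComplexInclusion (chainBot_anti h) w)
      (D.map (homOfLE (chainTop_mono h)).op x) = hocolimMk D c w x :=
  ConcreteCategory.congr_hom (colimit.w (hocolimDiagram D) (homOfLE h).op) (w, x)

theorem exists_hocolimMk_eq (p : hocolim D) : ∃ c w x, hocolimMk D c w x = p := by
  obtain ⟨c, ⟨w, x⟩, h⟩ := Concrete.colimit_exists_rep (hocolimDiagram D) p
  exact ⟨c.unop, w, x, h⟩

theorem isClosed_hocolim_iff (Z : Set (hocolim D)) :
    IsClosed Z ↔ ∀ c, IsClosed {p : OrderComplex (Set.Iic (chainBot c)) × D.obj (op (chainTop c)) |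
      hocolimMk D c p.1 p.2 ∈ Z} :=
  (TopCat.isClosed_iff_of_isColimit _ (colimit.isColimit (hocolimDiagram D)) Z).trans
    ⟨fun h c => h (op c), fun h c => h c.unop⟩

end Hocolim

/-! ### The comparison map -/

namespace SubspaceArrangement

variable {n : ℕ} {𝒜 : SubspaceArrangement n}

/-- Every point of the homotopy colimit of the Vassiliev diagram over `x` is represented over the
one-element chain consisting of the full face of `x`: both this chain and any chain carrying the
point are contained in their union, which is again a chain. -/
theorem exists_hocolimMk_fullFace (p : hocolim 𝒜.vassilievDiagram) :
    ∃ (x : E n) (hx : x ∈ 𝒜.union)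
      (w : OrderComplex (Set.Iic (chainBot (singletonChain (fullFace x hx)))))
      (h : ∀ a ∈ (chainTop (singletonChain (fullFace x hx))).1, x ∈ a.1.space),
      p = hocolimMk 𝒜.vassilievDiagram (singletonChain (fullFace x hx)) w ⟨x, h⟩ := by
  obtain ⟨c, w, x, rfl⟩ := exists_hocolimMk_eq _ p
  have hx : x.1 ∈ 𝒜.union := mem_union_of_face _ x.2
  have hle : chainTop c ≤ fullFace x.1 hx := fun a ha => mem_fullFace.2 (x.2 a ha)
  obtain ⟨d, hcd, hd, htop, hbot⟩ := exists_chain_above c hle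
  have hxd : ∀ a ∈ (chainTop d).1, x.1 ∈ a.1.space := fun a ha => by
    rw [htop] at ha
    exact mem_fullFace.1 ha
  let w' := orderComplexInclusion hbot.ge w
  have hw' : orderComplexInclusion (chainBot_anti hcd) w' = w :=
    flagWeights_injective ((flagWeights_inclusion _ _).trans (flagWeights_inclusion _ _))
  refine ⟨x.1, hx, orderComplexInclusion (chainBot_anti hd) w', fun a ha => ?_, ?_⟩
  · exact mem_fullFace.1 (chainTop_singletonChain (fullFace x.1 hx) ▸ ha)
  · refine Eq.trans ?_ (hocolimMk_map 𝒜.vassilievDiagram hd w' ⟨x.1, hxd⟩).symm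
    refine Eq.trans ?_ (hocolimMk_map 𝒜.vassilievDiagram hcd w' ⟨x.1, hxd⟩)
    rw [hw']
    rfl

namespace Embeddings

variable {N : ℕ} (e : 𝒜.Embeddings N)

/-- Barycentric subdivision covers the whole simplex `V(x)`. -/
theorem exists_subdivisionPoint_eq (x : E n) (hx : x ∈ 𝒜.union) {p : E N}
    (hp : p ∈ e.simplexOver x) : ∃ c w, ∃ y : 𝒜.vassilievDiagram.obj (op (chainTop c)),
      e.subdivisionPoint c w y = p := by
  rw [simplexOver, ← e.extension_image_fullFace x hx] at hp
  obtain ⟨l, h0, hz, h1, rfl⟩ := exists_weights_of_mem_convexHull_image _ _ hp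
  let s := (fullFace x hx).1.filter fun a => 0 < l a
  have hsub : s ⊆ (fullFace x hx).1 := Finset.filter_subset _ _
  obtain ⟨v, hv0, hvc, hvs, hvl⟩ := exists_vertexWeights_eq s l
    (fun a ha => (Finset.mem_filter.1 ha).2) fun a ha => by
      by_cases haF : a ∈ (fullFace x hx).1
      · exact le_antisymm (not_lt.1 fun h => ha (Finset.mem_filter.2 ⟨haF, h⟩)) (h0 a)
      · exact hz a haF
  have htop := chainTop_singletonChain (fullFace x hx)
  have hbot := chainBot_singletonChain (fullFace x hx)
  have hvs' : ∀ τ ∈ v.support, τ.Nonempty ∧ τ ⊆ (fullFace x hx).1 := fun τ hτ =>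
    ⟨(hvs τ hτ).1, (hvs τ hτ).2.trans hsub⟩
  obtain ⟨w, rfl⟩ := exists_flagWeights_eq (b := chainBot (singletonChain (fullFace x hx))) v hv0
    hvc (by rwa [hbot]) (by rw [← sum_vertexWeights hvs', hvl, h1])
  have hmem : ∀ a ∈ (chainTop (singletonChain (fullFace x hx))).1, x ∈ a.1.space := by
    rw [htop]
    exact fun a ha => mem_fullFace.1 ha
  refine ⟨singletonChain (fullFace x hx), w, ⟨x, hmem⟩,
    (e.subdivisionAffine_eq _ w ⟨x, hmem⟩).symm.trans
      ((e.subdivisionAffine_apply _ w x).trans ?_)⟩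
  rw [hvl, htop]

theorem continuous_subdivisionAffine (c : Bd (FacePoset 𝒜.nerve)) :
    Continuous fun p : OrderComplex (Set.Iic (chainBot c)) × E n =>
      e.subdivisionAffine c p.1 p.2 := by
  simp_rw [subdivisionAffine_apply]
  refine continuous_finsetSum _ fun a _ => ?_
  exact ((continuous_vertexWeights a).comp continuous_fst).smul
    ((e.extension a).continuous_of_finiteDimensional.comp continuous_snd)

theorem continuous_subdivisionPoint (c : Bd (FacePoset 𝒜.nerve)) :
    Continuous fun p : OrderComplex (Set.Iic (chainBot c)) ×
      𝒜.vassilievDiagram.obj (op (chainTop c)) => e.subdivisionPoint c p.1 p.2 := by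
  have hval : Continuous fun x : 𝒜.vassilievDiagram.obj (op (chainTop c)) => (x.1 : E n) :=
    continuous_subtype_val
  have hpair : Continuous fun p : OrderComplex (Set.Iic (chainBot c)) ×
      𝒜.vassilievDiagram.obj (op (chainTop c)) => (p.1, (p.2.1 : E n)) :=
    continuous_fst.prodMk (hval.comp continuous_snd)
  have h := (e.continuous_subdivisionAffine c).comp hpair
  have heq : (fun p : OrderComplex (Set.Iic (chainBot c)) ×
      𝒜.vassilievDiagram.obj (op (chainTop c)) => e.subdivisionPoint c p.1 p.2) =
      (fun p : OrderComplex (Set.Iic (chainBot c)) × E n => e.subdivisionAffine c p.1 p.2) ∘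
        fun p => (p.1, (p.2.1 : E n)) := funext fun p => (e.subdivisionAffine_eq c p.1 p.2).symm
  rw [heq]
  exact h

variable {e} in
/-- On each piece of the homotopy colimit the comparison map is proper: a coincidence of two values
of one of the affine maps in the family would be a common point of two simplices `V(x)`. -/
theorem IsGeneric.isProperMap_subdivisionPoint (he : e.IsGeneric) (c : Bd (FacePoset 𝒜.nerve)) :
    IsProperMap fun p : OrderComplex (Set.Iic (chainBot c)) ×
      𝒜.vassilievDiagram.obj (op (chainTop c)) => e.subdivisionPoint c p.1 p.2 := by
  let B : AffineSubspace ℝ (E n) := ⨅ a ∈ (chainTop c).1, a.1.space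
  have hB : ∀ x, x ∈ B ↔ ∀ a ∈ (chainTop c).1, x ∈ a.1.space := fun x => by
    simp [B, ← SetLike.mem_coe, AffineSubspace.coe_iInf]
  have h := isProperMap_of_affine_family B (e.subdivisionAffine c)
    (e.continuous_subdivisionAffine c) fun w x hx y hy hxy => by
      have hx := (hB x).1 hx
      have hy := (hB y).1 hy
      exact he.eq_of_mem_simplexOver (mem_union_of_face _ hx) (mem_union_of_face _ hy)
        (e.subdivisionAffine_mem_simplexOver c w x hx)
        (hxy ▸ e.subdivisionAffine_mem_simplexOver c w y hy)
  let φ : 𝒜.vassilievDiagram.obj (op (chainTop c)) ≃ₜ B :=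
    Homeomorph.setCongr (s := {x | ∀ a ∈ (chainTop c).1, x ∈ a.1.space}) (t := (B : Set (E n)))
      (Set.ext fun x => (hB x).symm)
  have heq : (fun p : OrderComplex (Set.Iic (chainBot c)) ×
      𝒜.vassilievDiagram.obj (op (chainTop c)) => e.subdivisionPoint c p.1 p.2) =
      (fun p : OrderComplex (Set.Iic (chainBot c)) × B => e.subdivisionAffine c p.1 p.2) ∘
        (Homeomorph.refl (OrderComplex (Set.Iic (chainBot c)))).prodCongr φ :=
    funext fun p => (e.subdivisionAffine_eq c p.1 p.2).symm
  rw [heq]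
  exact h.comp (Homeomorph.isProperMap _)

theorem subdivisionPoint_map {c d : Bd (FacePoset 𝒜.nerve)} (h : d ≤ c)
    (w : OrderComplex (Set.Iic (chainBot c))) (x : 𝒜.vassilievDiagram.obj (op (chainTop c))) :
    e.subdivisionPoint d (orderComplexInclusion (chainBot_anti h) w)
      (𝒜.vassilievDiagram.map (homOfLE (chainTop_mono h)).op x) = e.subdivisionPoint c w x := by
  unfold subdivisionPoint
  rw [orderComplexInclusion_val, Finsupp.sum_mapDomain_index (by simp) fun _ _ _ => add_smul _ _ _]
  rfl

/-- The cocone on the diagram of the homotopy colimit given by barycentric subdivision of the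
simplices `V(x)`. -/
noncomputable def subdivisionCocone : Cocone (hocolimDiagram 𝒜.vassilievDiagram) where
  pt := TopCat.of e.resolution
  ι :=
    { app := fun c => TopCat.ofHom ⟨fun p =>
        ⟨e.subdivisionPoint c.unop p.1 p.2, e.subdivisionPoint_mem_resolution c.unop p.1 p.2⟩,
        (e.continuous_subdivisionPoint c.unop).subtype_mk _⟩
      naturality := fun _ _ f => TopCat.hom_ext (ContinuousMap.ext fun p =>
        Subtype.ext (e.subdivisionPoint_map (leOfHom f.unop) p.1 p.2)) }

/-- The map from the homotopy colimit of the Vassiliev diagram to the geometric resolution given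
by barycentric subdivision of the simplices `V(x)`. -/
noncomputable def comparison : C(hocolim 𝒜.vassilievDiagram, e.resolution) :=
  (colimit.desc (hocolimDiagram 𝒜.vassilievDiagram) e.subdivisionCocone).hom

theorem comparison_hocolimMk (c : Bd (FacePoset 𝒜.nerve))
    (w : OrderComplex (Set.Iic (chainBot c))) (x : 𝒜.vassilievDiagram.obj (op (chainTop c))) :
    (e.comparison (hocolimMk 𝒜.vassilievDiagram c w x) : E N) = e.subdivisionPoint c w x :=
  congrArg (fun q : e.resolution => (q : E N))
    (ConcreteCategory.congr_hom (colimit.ι_desc e.subdivisionCocone (op c)) (w, x))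

theorem comparison_surjective : Function.Surjective e.comparison := by
  rintro ⟨p, hp⟩
  have hp' := hp
  simp only [resolution, Set.mem_iUnion] at hp'
  obtain ⟨x, hx, hpx⟩ := hp'
  obtain ⟨c, w, y, h⟩ := e.exists_subdivisionPoint_eq x hx hpx
  exact ⟨hocolimMk 𝒜.vassilievDiagram c w y, Subtype.ext ((e.comparison_hocolimMk c w y).trans h)⟩

variable {e}

theorem IsGeneric.comparison_injective (he : e.IsGeneric) : Function.Injective e.comparison := by
  intro p q hpq
  obtain ⟨x, hx, w, h, rfl⟩ := exists_hocolimMk_fullFace p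
  obtain ⟨y, hy, w', h', rfl⟩ := exists_hocolimMk_fullFace q
  have hpq := (e.comparison_hocolimMk _ w ⟨x, h⟩).symm.trans
    ((congrArg (fun q : e.resolution => (q : E N)) hpq).trans (e.comparison_hocolimMk _ w' ⟨y, h'⟩))
  obtain rfl : x = y := he.eq_of_mem_simplexOver hx hy
    (e.subdivisionPoint_mem_simplexOver _ w ⟨x, h⟩)
    (hpq ▸ e.subdivisionPoint_mem_simplexOver _ w' ⟨y, h'⟩)
  rw [he.subdivisionPoint_injective w w' _ hpq]

/-- The comparison map is closed, because the homotopy colimit is glued from finitely many pieces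
and its restriction to each piece is proper. -/
theorem IsGeneric.isClosedMap_comparison (he : e.IsGeneric) : IsClosedMap e.comparison := by
  intro Z hZ
  rw [isClosed_hocolim_iff] at hZ
  have : Finite (Bd (FacePoset 𝒜.nerve)) :=
    Finite.of_injective PartialOrder.NonemptyFiniteChains.finset
      fun _ _ => PartialOrder.NonemptyFiniteChains.ext
  have himage : e.comparison '' Z = Subtype.val ⁻¹' ⋃ c : Bd (FacePoset 𝒜.nerve),
      (fun p : OrderComplex (Set.Iic (chainBot c)) × 𝒜.vassilievDiagram.obj (op (chainTop c)) =>
        e.subdivisionPoint c p.1 p.2) ''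
          {p | hocolimMk 𝒜.vassilievDiagram c p.1 p.2 ∈ Z} := by
    ext q
    simp only [Set.mem_image, Set.mem_preimage, Set.mem_iUnion]
    constructor
    · rintro ⟨p, hp, rfl⟩
      obtain ⟨c, w, x, rfl⟩ := exists_hocolimMk_eq _ p
      exact ⟨c, (w, x), hp, (e.comparison_hocolimMk c w x).symm⟩
    · rintro ⟨c, ⟨w, x⟩, hp, h⟩
      exact ⟨_, hp, Subtype.ext ((e.comparison_hocolimMk c w x).trans h)⟩
  rw [himage]
  exact (isClosed_iUnion_of_finite fun c =>
    (he.isProperMap_subdivisionPoint c).isClosedMap _ (hZ c)).preimage continuous_subtype_val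

/-- For a generic system, barycentric subdivision identifies the homotopy colimit of the Vassiliev
diagram with the geometric resolution. -/
noncomputable def IsGeneric.comparisonHomeomorph (he : e.IsGeneric) :
    hocolim 𝒜.vassilievDiagram ≃ₜ e.resolution :=
  (Equiv.ofBijective e.comparison ⟨he.comparison_injective, e.comparison_surjective⟩)
    |>.toHomeomorphOfContinuousClosed e.comparison.continuous he.isClosedMap_comparison

/-! ### Existence of generic systems -/

/-- The direct sum of one copy of `ℝ × ℝⁿ` for each subspace. -/
abbrev BlockSpace (𝒜 : SubspaceArrangement n) : Type := 𝒜.subspaces → ℝ × E n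

open Classical in
/-- Each subspace is put, at height `1`, into its own block. -/
noncomputable def blockEmbedding (L : BlockSpace 𝒜 →ₗ[ℝ] E N) (hL : Function.Injective L) :
    𝒜.Embeddings N where
  toFun A := (L ∘ₗ LinearMap.single ℝ (fun _ => ℝ × E n) A).toAffineMap.comp
    ((AffineMap.const ℝ _ (1 : ℝ)).prod A.1.subtype)
  injective A _ _ h := Subtype.ext (congrArg Prod.snd (Pi.single_injective A (hL h)))

open Classical in
theorem blockEmbedding_images (L : BlockSpace 𝒜 →ₗ[ℝ] E N) (hL : Function.Injective L) (x : E n)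
    (A : {A : 𝒜.subspaces // x ∈ A.1}) :
    (blockEmbedding L hL).images x A = L (Pi.single A.1 (1, x)) := rfl

theorem isGeneric_blockEmbedding (L : BlockSpace 𝒜 →ₗ[ℝ] E N) (hL : Function.Injective L) :
    (blockEmbedding L hL).IsGeneric := by
  classical
  have hsum : ∀ (x : E n) (s : Finset {A : 𝒜.subspaces // x ∈ A.1})
      (l : {A : 𝒜.subspaces // x ∈ A.1} → ℝ),
      ∑ A ∈ s, l A • (blockEmbedding L hL).images x A =
        L (∑ A ∈ s, Pi.single A.1 (l A • ((1 : ℝ), x))) := by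
    intro x s l
    simp only [blockEmbedding_images, map_sum]
    refine Finset.sum_congr rfl fun A _ => ?_
    rw [← map_smul, Pi.single_smul]
  constructor
  · intro x _
    rw [affineIndependent_iff]
    intro s l _ h A hA
    rw [hsum, ← map_zero L] at h
    have := congrArg Prod.fst (congrFun (hL h) A.1)
    rw [Finset.sum_apply, Finset.sum_eq_single_of_mem A hA fun A' _ hne =>
      Pi.single_eq_of_ne (fun h => hne (Subtype.ext h.symm)) _, Pi.single_eq_same] at this
    simpa using this
  · intro x _ y _ hxy
    -- the blocks of a point of `V(z)` are multiples of `(1, z)`, and they do not all vanish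
    have key : ∀ z : E n, (blockEmbedding L hL).simplexOver z ⊆
        L '' {q | (∀ A, (q A).2 = (q A).1 • z) ∧ ∑ A, (q A).1 = 1} := by
      intro z
      refine convexHull_min ?_ (Convex.linear_image ?_ L)
      · rintro _ ⟨A, rfl⟩
        refine ⟨Pi.single A.1 (1, z), ⟨fun B => ?_, ?_⟩, rfl⟩
        · by_cases h : B = A.1
          · subst h
            simp
          · simp [Pi.single_eq_of_ne h]
        · rw [Finset.sum_eq_single A.1 (fun B _ h => by simp [Pi.single_eq_of_ne h]) (by simp)]
          simp
      · rintro q ⟨h1, h2⟩ q' ⟨h1', h2'⟩ a b _ _ hab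
        refine ⟨fun A => ?_, ?_⟩
        · simp only [Pi.add_apply, Pi.smul_apply, Prod.snd_add, Prod.smul_snd, Prod.fst_add,
            Prod.smul_fst, h1 A, h1' A, add_smul, smul_assoc]
        · simp only [Pi.add_apply, Pi.smul_apply, Prod.fst_add, Prod.smul_fst,
            Finset.sum_add_distrib, smul_eq_mul, ← Finset.mul_sum, h2, h2', mul_one, hab]
    rw [Set.disjoint_left]
    intro p hpx hpy
    obtain ⟨q, ⟨h1, h2⟩, rfl⟩ := key x hpx
    obtain ⟨q', ⟨h1', -⟩, h⟩ := key y hpy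
    obtain rfl := hL h
    obtain ⟨A, -, hA⟩ := Finset.exists_ne_zero_of_sum_ne_zero (h2.trans_ne one_ne_zero)
    exact hxy (smul_right_injective (E n) hA ((h1 A).symm.trans (h1' A)))

end Embeddings

variable (𝒜) in
theorem exists_isGeneric : ∃ N₀ : ℕ, ∀ N ≥ N₀, ∃ e : 𝒜.Embeddings N, e.IsGeneric := by
  refine ⟨Module.finrank ℝ (Embeddings.BlockSpace 𝒜), fun N hN => ?_⟩
  obtain ⟨L, hL⟩ := rank_le_iff_exists_linearMap (R := ℝ) (M := Embeddings.BlockSpace 𝒜)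
    (M₁ := E N) |>.1 (by
      rw [← Module.finrank_eq_rank, ← Module.finrank_eq_rank, Nat.cast_le,
        finrank_euclideanSpace_fin]
      exact hN)
  exact ⟨_, Embeddings.isGeneric_blockEmbedding L hL⟩

end SubspaceArrangement

end VassilievModel

open VassilievModel in
theorem theorem3p5 (n : ℕ) (𝒜 : SubspaceArrangement n) :
    (∃ N₀ : ℕ, ∀ N ≥ N₀, ∃ e : 𝒜.Embeddings N, e.IsGeneric) ∧
    ∀ (N : ℕ) (e : 𝒜.Embeddings N), e.IsGeneric →
      ∃ Φ : OnePoint (hocolim 𝒜.vassilievDiagram) ≃ₜ OnePoint e.resolution,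
        Φ OnePoint.infty = OnePoint.infty ∧
        ∀ (c : Bd (FacePoset 𝒜.nerve))
          (w : OrderComplex (Set.Iic (chainBot c)))
          (x : 𝒜.vassilievDiagram.obj (Opposite.op (chainTop c))),
          ∃ p : e.resolution,
            Φ (OnePoint.some (hocolimMk 𝒜.vassilievDiagram c w x)) = OnePoint.some p ∧
            (p : E N) = e.subdivisionPoint c w x := by
  refine ⟨𝒜.exists_isGeneric, fun N e he => ?_⟩
  exact ⟨he.comparisonHomeomorph.onePointCongr, rfl, fun c w x =>
    ⟨e.comparison (hocolimMk 𝒜.vassilievDiagram c w x), rfl, e.comparison_hocolimMk c w x⟩⟩
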